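/- **Theorem (Linear OSRB).** Let $\mathbb F$ be a finite field, let $t,\ell_1,\dots,\ell_t\ge 0$ be integers, and let $(M_1,\dots,M_t,C)$ be random variables with joint pmf $p$, where $M_i$ takes values in $\mathcal M_i=\mathbb F^{\ell_i}$ and $C$ takes values in a finite set $\mathcal C$. Let $(\mathbf M^n,C^n)$ be $n$ i.i.d. repetitions of $(M_1,\dots,M_t,C)$, with pmf $p(\mathbf m^n,c^n)=\prod_{j=1}^n p(m_{1,j},\dots,m_{t,j},c_j)$, and regard $M_i^n$ as a vector of $n\ell_i$ symbols of $\mathbb F$. Let $R_1,\dots,R_t$ be real numbers such that $$\sum_{i\in\mathcal S}R_i<H(M_{\mathcal S}\mid C)\qquad\text{for every nonempty }\mathcal S\subseteq\{1,\dots,t\},$$ where $M_{\mathcal S}=(M_i)_{i\in\mathcal S}$ and entropy is in bits, and let $k_i(n)\ge 0$ be integers with $\frac1n k_i(n)\log_2|\mathbb F|\to R_i$ as $n\to\infty$ for each $i$ (for example $k_i(n)=\lfloor nR_i/\log_2|\mathbb F|\rfloor$ when $R_i\ge 0$). Put $\bar{\mathcal M}_i=\mathbb F^{k_i(n)}$.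 For functions $\mathfrak B_i:\mathcal M_i^n\to\bar{\mathcal M}_i$ let $$P(c^n,\bar{\mathbf m})=\sum_{\mathbf m^n}p(\mathbf m^n,c^n)\prod_{i=1}^t\mathbb 1[\mathfrak B_i(m_i^n)=\bar m_i]$$ be the resulting joint pmf of $C^n$ and the bin indices, let $p^U_{\bar{\mathcal M}_i}$ be the uniform pmf on $\bar{\mathcal M}_i$, and let $\|P-Q\|_1=\frac12\sum_x|P(x)-Q(x)|$. (a) Let $\mathfrak B_i(m_i^n)=A_im_i^n+V_i$ where $A_i\in\mathbb F^{k_i(n)\times n\ell_i}$ and $V_i\in\mathbb F^{k_i(n)}$, $i=1,\dots,t$, have mutually independent entries that are uniform over $\mathbb F$. Then $$\lim_{n\to\infty}\mathbb E_{\mathfrak B}\Big\|P(c^n,\bar{\mathbf m})-p(c^n)\prod_{i=1}^tp^U_{\bar{\mathcal M}_i}(\bar m_i)\Big\|_1=0 .$$ (b) The same limit holds whenever, for each $n$, the random functions $\mathfrak B_i:\mathcal M_i^n\to\bar{\mathcal M}_i$, $i=1,\dots,t$, are mutually independent and each of them satisfies uniformity, $\mathbb P(\mathfrak B_i(x)=y)=1/|\bar{\mathcal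 M}_i|$ for all $x,y$, and pairwise independence, $\mathbb P(\mathfrak B_i(x)=y,\ \mathfrak B_i(x')=y')=1/|\bar{\mathcal M}_i|^2$ for all $x\ne x'$ and all $y,y'$. -/

import Mathlib

open Filter Topology

namespace OSRB

noncomputable section

/-- Total variation distance `½ ∑ |P - Q|` of two mass functions on a finite set. -/
def totalVariation {α : Type*} [Fintype α] (P Q : α → ℝ) : ℝ :=
  (1 / 2) * ∑ a, |P a - Q a|

/-- Conditional Shannon entropy in bits, `H(X | Y) = - ∑ p(x, y) log₂ p(x | y)`,
of a pair `(X, Y)` with joint pmf `q`. -/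
def condEntropy {X Y : Type*} [Fintype X] [Fintype Y] (q : PMF (X × Y)) : ℝ :=
  - ∑ x, ∑ y, (q (x, y)).toReal *
      Real.logb 2 ((q (x, y)).toReal / (q.map Prod.snd y).toReal)

section Source

variable {t : ℕ} {M : Fin t → Type*} {C : Type*}

/-- The joint pmf of `(M_S, C)` when `(M_1, …, M_t, C)` has joint pmf `p`. -/
def subsetPmf (p : PMF ((∀ i, M i) × C)) (S : Finset (Fin t)) :
    PMF ((∀ i : S, M i) × C) :=
  p.map fun x => (fun i => x.1 i, x.2)

/-- `p(m^n, c^n) = ∏ j, p(m_{1,j}, …, m_{t,j}, c_j)`, the pmf of `n` i.i.d. repetitions;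
`m i j` is the `j`-th repetition of the `i`-th variable. -/
def iidPmf (p : PMF ((∀ i, M i) × C)) (n : ℕ)
    (m : ∀ i, Fin n → M i) (c : Fin n → C) : ℝ :=
  ∏ j, (p (fun i => m i j, c j)).toReal

variable [∀ i, Fintype (M i)] {Y : Fin t → Type*}

/-- `P(c^n, y)`: the marginal of `p(m^n, c^n) ∏ i, 1[B_i(m_i^n) = y_i]`, i.e. the joint pmf of
`C^n` and the bin indices, for fixed binning functions `B_i`. -/
def binnedPmf [∀ i, DecidableEq (Y i)] (p : PMF ((∀ i, M i) × C)) (n : ℕ)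
    (B : ∀ i, (Fin n → M i) → Y i) (c : Fin n → C) (y : ∀ i, Y i) : ℝ :=
  ∑ m : ∀ i, Fin n → M i, iidPmf p n m c * ∏ i, if B i (m i) = y i then 1 else 0

/-- `p(c^n) ∏ i, p^U(y_i)` with `p^U` uniform on the set of bin indices. -/
def idealPmf [∀ i, Fintype (Y i)] [∀ i, Nonempty (Y i)] (p : PMF ((∀ i, M i) × C)) (n : ℕ)
    (c : Fin n → C) (y : ∀ i, Y i) : ℝ :=
  (∑ m : ∀ i, Fin n → M i, iidPmf p n m c) * ∏ i, (PMF.uniformOfFintype (Y i) (y i)).toReal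

/-- The expectation of `‖P(c^n, y) - p(c^n) ∏ i, p^U(y_i)‖` when the binning functions
`B_1, …, B_t` are random and mutually independent, `B_i` having the law `law i`. -/
def expectedDistance [∀ i, DecidableEq (M i)] [Fintype C]
    [∀ i, Fintype (Y i)] [∀ i, Nonempty (Y i)] [∀ i, DecidableEq (Y i)]
    (p : PMF ((∀ i, M i) × C)) (n : ℕ) (law : ∀ i, PMF ((Fin n → M i) → Y i)) : ℝ :=
  ∑ B : ∀ i, (Fin n → M i) → Y i, (∏ i, (law i (B i)).toReal) *
    totalVariation
      (fun z : (Fin n → C) × (∀ i, Y i) => binnedPmf p n B z.1 z.2)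
      (fun z : (Fin n → C) × (∀ i, Y i) => idealPmf p n z.1 z.2)

end Source

/-- The affine map `m^n ↦ A m^n + V`, where `n` repetitions of a vector of `l` symbols
are read as one vector of `n * l` symbols of `F`. -/
def affineBinning {F : Type*} [Field F] {n l k : ℕ}
    (A : Matrix (Fin k) (Fin n × Fin l) F) (V : Fin k → F) :
    (Fin n → Fin l → F) → (Fin k → F) :=
  fun m => A.mulVec (fun s => m s.1 s.2) + V

/-- The law of the random function `m^n ↦ A m^n + V` when all entries of `A` and `V` are
mutually independent and uniform over `F`, i.e. when `(A, V)` is uniformly distributed. -/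
def linearBinningLaw (F : Type*) [Field F] [Fintype F] [DecidableEq F] (n l k : ℕ) :
    PMF ((Fin n → Fin l → F) → (Fin k → F)) :=
  (PMF.uniformOfFintype (Matrix (Fin k) (Fin n × Fin l) F × (Fin k → F))).map
    fun AV => affineBinning AV.1 AV.2

/-- Uniformity of a random function: `ℙ(B(x) = y) = 1 / |Y|`. -/
def IsUniformBinning {X Y : Type*} [Fintype Y] (law : PMF (X → Y)) : Prop :=
  ∀ (x : X) (y : Y), (law.toOuterMeasure {B | B x = y}).toReal = 1 / (Fintype.card Y : ℝ)

/-- Pairwise independence of a uniform random function: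
`ℙ(B(x) = y, B(x') = y') = 1 / |Y|²` for distinct `x`, `x'`. -/
def IsPairwiseIndepBinning {X Y : Type*} [Fintype Y] (law : PMF (X → Y)) : Prop :=
  ∀ (x x' : X), x ≠ x' → ∀ y y' : Y,
    (law.toOuterMeasure {B | B x = y ∧ B x' = y'}).toReal = 1 / (Fintype.card Y : ℝ) ^ 2

end

end OSRB

/-!
Fix `c^n`, and replace the source by its restriction `q` to the tuples `(m^n, c^n)` that satisfy
`p(m_S^n | c^n) ≤ exp (-n a_S)` for every nonempty `S`, where `a_S` lies strictly between
`∑ i ∈ S, R i` and `H(M_S | C)`, both converted to nats.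

The restriction costs little: `log p(m_S^n | c^n)` is a sum of i.i.d. terms of mean
`-H(M_S | C) < -a_S`, so the removed mass is exponentially small by Chernoff's bound
(`exists_chernoff_rate`, `exists_atypical_rate`).

For the restricted source, the mass put on a tuple of bins has mean `q(c^n) / ∏ i, |Y_i|` by
uniformity and independence of the binnings. In its variance, a pair `m`, `m'` contributes only
if the set of indices where the two agree is nonempty; for such a set `S` the probability that
both fall into the given bins exceeds the product of the two probabilities by the factor
`∏ i ∈ S, |Y_i|`, while the total mass of the `m'`
agreeing with `m` on `S` is at most `p(c^n) exp (-n a_S)` (`variance_le`,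
`sum_agree_le_of_isTypical`). By Cauchy–Schwarz the expected `L¹` distance, summed over all bins
and all `c^n`, is at most the square root of `∑ S, (∏ i ∈ S, |Y_i|) exp (-n a_S)`
(`sum_expected_abs_le`, `expectedDistance_le`), which tends to `0` by the choice of `a_S`
(`tendsto_prod_card_mul_exp`).

The random affine maps are a special case: for `x ≠ x'` the map `(A, V) ↦ (A x + V, A x' + V)` is
a surjective homomorphism, so it carries the uniform law to the uniform law (`uniform_fiber`).
-/

namespace OSRB

/-! ### Finite sums of probabilities -/

theorem sum_toReal_eq_one {α : Type*} [Fintype α] (q : PMF α) : ∑ a, (q a).toReal = 1 := by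
  rw [← ENNReal.toReal_sum fun a _ => q.apply_ne_top a, ← tsum_fintype (L := .unconditional α),
    q.tsum_coe, ENNReal.toReal_one]

theorem toReal_map_apply {α β : Type*} [Fintype α] [DecidableEq β] (q : PMF α) (f : α → β)
    (b : β) : (q.map f b).toReal = ∑ a, if f a = b then (q a).toReal else 0 := by
  rw [PMF.map_apply, tsum_fintype, ENNReal.toReal_sum]
  · refine Finset.sum_congr rfl fun a _ => ?_
    by_cases h : f a = b
    · simp [h]
    · simp [h, Ne.symm h]
  · intro a _
    split_ifs
    · exact q.apply_ne_top a
    · exact ENNReal.zero_ne_top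

theorem sum_toReal_map_mul {α β : Type*} [Fintype α] [Fintype β] (q : PMF α)
    (f : α → β) (φ : β → ℝ) :
    ∑ b, (q.map f b).toReal * φ b = ∑ a, (q a).toReal * φ (f a) := by
  classical
  simp_rw [toReal_map_apply, Finset.sum_mul]
  rw [Finset.sum_comm]
  refine Finset.sum_congr rfl fun a _ => ?_
  simp [ite_mul]

theorem toReal_toOuterMeasure_apply {α : Type*} [Fintype α] (q : PMF α) (s : α → Prop)
    [DecidablePred s] :
    (q.toOuterMeasure {a | s a}).toReal = ∑ a, (q a).toReal * if s a then 1 else 0 := by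
  rw [PMF.toOuterMeasure_apply, tsum_fintype, ENNReal.toReal_sum]
  · refine Finset.sum_congr rfl fun a _ => ?_
    by_cases h : s a <;> simp [Set.indicator, h]
  · intro a _
    by_cases h : s a <;> simp [Set.indicator, h, q.apply_ne_top a]

/-! ### Exponential tail bounds -/

section Chernoff

/-- The function `s ↦ 𝔼 exp (s (L - b))` has value `1` and derivative `𝔼 L - b < 0` at `0`. -/
theorem exists_exponential_moment_lt {Ω : Type*} [Fintype Ω] (w L : Ω → ℝ)
    (hw : ∑ x, w x = 1) {b : ℝ} (hb : ∑ x, w x * L x < b) :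
    ∃ s > 0, ∑ x, w x * Real.exp (s * (L x - b)) < 1 := by
  have hd : HasDerivAt (fun s : ℝ => ∑ x, w x * Real.exp (s * (L x - b)))
      (∑ x, w x * (L x - b)) 0 := by
    refine HasDerivAt.fun_sum fun x _ => ?_
    have h := (((hasDerivAt_id (0 : ℝ)).mul_const (L x - b)).exp).const_mul (w x)
    simpa using h
  have hneg : ∑ x, w x * (L x - b) < 0 := by
    simp_rw [mul_sub, Finset.sum_sub_distrib, ← Finset.sum_mul, hw]
    linarith
  have h0 : ∑ x, w x * Real.exp (0 * (L x - b)) = 1 := by simpa using hw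
  obtain ⟨s, hs, hpos⟩ :=
    ((hd.tendsto_slope_zero_right.eventually (gt_mem_nhds hneg)).and self_mem_nhdsWithin).exists
  have hpos : 0 < s := hpos
  refine ⟨s, hpos, ?_⟩
  rw [zero_add, h0, smul_eq_mul] at hs
  linarith [neg_of_mul_neg_right hs (inv_pos.2 hpos).le]

/-- Chernoff's bound: under `n` independent draws from `w`, the sum of `L` exceeds `n * b`, with
`b` larger than the mean of `L`, with probability exponentially small in `n`. -/
theorem exists_chernoff_rate {Ω : Type*} [Fintype Ω] (w L : Ω → ℝ) (hw0 : ∀ x, 0 ≤ w x)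
    (hw : ∑ x, w x = 1) {b : ℝ} (hb : ∑ x, w x * L x < b) :
    ∃ r : ℝ, 0 ≤ r ∧ r < 1 ∧ ∀ n : ℕ,
      ∑ x : Fin n → Ω, (∏ j, w (x j)) * (if n * b < ∑ j, L (x j) then 1 else 0) ≤ r ^ n := by
  obtain ⟨s, hs, hlt⟩ := exists_exponential_moment_lt w L hw hb
  refine ⟨_, Finset.sum_nonneg fun x _ => mul_nonneg (hw0 x) (Real.exp_pos _).le, hlt,
    fun n => ?_⟩
  rw [Fintype.sum_pow]
  refine Finset.sum_le_sum fun x _ => ?_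
  rw [Finset.prod_mul_distrib, ← Real.exp_sum]
  refine mul_le_mul_of_nonneg_left ?_ (Finset.prod_nonneg fun j _ => hw0 _)
  split_ifs with h
  · rw [← Finset.mul_sum, Finset.sum_sub_distrib]
    refine Real.one_le_exp (mul_nonneg hs.le ?_)
    simp only [Finset.sum_const, Finset.card_univ, Fintype.card_fin, nsmul_eq_mul]
    linarith
  · exact (Real.exp_pos _).le

end Chernoff

/-! ### Pairwise independent binning of a fixed mass function -/

section OneShot

variable {ι : Type*} [Fintype ι] {X Y : ι → Type*}

/-- The probability of the tuple `B` of binning functions when `B_1, …, B_t` are independent. -/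
noncomputable def lawWeight (law : ∀ i, PMF (X i → Y i)) (B : ∀ i, X i → Y i) : ℝ :=
  ∏ i, (law i (B i)).toReal

theorem lawWeight_nonneg (law : ∀ i, PMF (X i → Y i)) (B : ∀ i, X i → Y i) :
    0 ≤ lawWeight law B := Finset.prod_nonneg fun _ _ => ENNReal.toReal_nonneg

/-- The indicator that all the components of `m` fall into the bins `y`. -/
def hit [∀ i, DecidableEq (Y i)] (B : ∀ i, X i → Y i) (m : ∀ i, X i) (y : ∀ i, Y i) : ℝ :=
  ∏ i, if B i (m i) = y i then 1 else 0

theorem hit_nonneg [∀ i, DecidableEq (Y i)] (B : ∀ i, X i → Y i) (m : ∀ i, X i) (y : ∀ i, Y i) :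
    0 ≤ hit B m y := Finset.prod_nonneg fun i _ => by split_ifs <;> norm_num

variable [DecidableEq ι] [∀ i, Fintype (Y i)]

theorem sum_hit [∀ i, DecidableEq (Y i)] (B : ∀ i, X i → Y i) (m : ∀ i, X i) :
    ∑ y, hit B m y = 1 := by
  unfold hit
  rw [← Fintype.prod_sum fun i b => if B i (m i) = b then (1 : ℝ) else 0]
  simp

theorem card_pi_mul_prod [∀ i, Nonempty (Y i)] :
    (Fintype.card (∀ i, Y i) : ℝ) * ∏ i, (1 / Fintype.card (Y i) : ℝ) = 1 := by
  rw [Fintype.card_pi, Nat.cast_prod, ← Finset.prod_mul_distrib]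
  exact Finset.prod_eq_one fun i _ =>
    mul_one_div_cancel (Nat.cast_ne_zero.2 Fintype.card_ne_zero)

variable [∀ i, DecidableEq (X i)]

/-- If the set where `m` and `m'` agree is empty, the left side vanishes; otherwise that set is one
of the `S` in the sum. -/
theorem prod_ite_sub_one_le [∀ i, Nonempty (Y i)] (m m' : ∀ i, X i) :
    (∏ i, if m i = m' i then (Fintype.card (Y i) : ℝ) else 1) - 1 ≤
      ∑ S : Finset ι with S.Nonempty, (∏ i ∈ S, (Fintype.card (Y i) : ℝ)) *
        if ∀ i ∈ S, m i = m' i then 1 else 0 := by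
  have hnn : ∀ S : Finset ι, 0 ≤ (∏ i ∈ S, (Fintype.card (Y i) : ℝ)) *
      if ∀ i ∈ S, m i = m' i then (1 : ℝ) else 0 := fun S =>
    mul_nonneg (Finset.prod_nonneg fun _ _ => Nat.cast_nonneg _) (by split_ifs <;> norm_num)
  rw [← Finset.prod_filter]
  rcases (Finset.univ.filter fun i => m i = m' i).eq_empty_or_nonempty with h | h
  · rw [h]
    simpa using Finset.sum_nonneg fun S _ => hnn S
  · have := Finset.single_le_sum (f := fun S : Finset ι => (∏ i ∈ S, (Fintype.card (Y i) : ℝ)) *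
      if ∀ i ∈ S, m i = m' i then (1 : ℝ) else 0) (s := Finset.univ.filter Finset.Nonempty)
      (fun S _ => hnn S) (Finset.mem_filter.2 ⟨Finset.mem_univ _, h⟩)
    simp only [Finset.mem_filter, Finset.mem_univ, true_and, imp_self, implies_true, if_true,
      mul_one] at this
    linarith

variable [∀ i, Fintype (X i)]

theorem sum_lawWeight_mul_prod (law : ∀ i, PMF (X i → Y i)) (φ : ∀ i, (X i → Y i) → ℝ) :
    ∑ B, lawWeight law B * ∏ i, φ i (B i) = ∏ i, ∑ b, (law i b).toReal * φ i b := by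
  simp_rw [lawWeight, ← Finset.prod_mul_distrib]
  exact (Fintype.prod_sum fun i b => (law i b).toReal * φ i b).symm

theorem sum_lawWeight (law : ∀ i, PMF (X i → Y i)) : ∑ B, lawWeight law B = 1 := by
  simpa [sum_toReal_eq_one] using sum_lawWeight_mul_prod law fun _ _ => 1

variable [∀ i, DecidableEq (Y i)]

theorem sum_lawWeight_mul_hit {law : ∀ i, PMF (X i → Y i)}
    (hu : ∀ i, IsUniformBinning (law i)) (m : ∀ i, X i) (y : ∀ i, Y i) :
    ∑ B, lawWeight law B * hit B m y = ∏ i, (1 / Fintype.card (Y i) : ℝ) := by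
  refine (sum_lawWeight_mul_prod law fun i b => if b (m i) = y i then 1 else 0).trans ?_
  refine Finset.prod_congr rfl fun i _ => ?_
  rw [← hu i (m i) (y i), toReal_toOuterMeasure_apply]

theorem sum_lawWeight_mul_hit_mul_hit [∀ i, Nonempty (Y i)] {law : ∀ i, PMF (X i → Y i)}
    (hu : ∀ i, IsUniformBinning (law i)) (hp : ∀ i, IsPairwiseIndepBinning (law i))
    (m m' : ∀ i, X i) (y : ∀ i, Y i) :
    ∑ B, lawWeight law B * (hit B m y * hit B m' y) =
      (∏ i, (1 / Fintype.card (Y i) : ℝ)) ^ 2 *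
        ∏ i, if m i = m' i then (Fintype.card (Y i) : ℝ) else 1 := by
  simp_rw [hit, ← Finset.prod_mul_distrib]
  refine (sum_lawWeight_mul_prod law fun i b =>
    (if b (m i) = y i then 1 else 0) * (if b (m' i) = y i then 1 else 0)).trans ?_
  rw [← Finset.prod_pow, ← Finset.prod_mul_distrib]
  refine Finset.prod_congr rfl fun i _ => ?_
  have hY : (Fintype.card (Y i) : ℝ) ≠ 0 := Nat.cast_ne_zero.2 Fintype.card_ne_zero
  by_cases h : m i = m' i
  · have := hu i (m i) (y i)
    rw [toReal_toOuterMeasure_apply] at this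
    rw [if_pos h, ← h]
    simp only [mul_ite, mul_one, mul_zero, ← ite_and, and_self] at this ⊢
    rw [this]
    field_simp
  · have := hp i _ _ h (y i) (y i)
    rw [toReal_toOuterMeasure_apply] at this
    rw [if_neg h, mul_one, div_pow, one_pow, ← this]
    refine Finset.sum_congr rfl fun b _ => ?_
    by_cases h1 : b (m i) = y i <;> by_cases h2 : b (m' i) = y i <;> simp [h1, h2]

/-- The variance of the mass that independent pairwise independent binnings put on a fixed tuple
of bins. Only pairs `m`, `m'` that agree on some nonempty set `S` of coordinates contribute, and
`hβ` controls the mass of those. -/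
theorem variance_le [∀ i, Nonempty (Y i)] {law : ∀ i, PMF (X i → Y i)}
    (hu : ∀ i, IsUniformBinning (law i)) (hp : ∀ i, IsPairwiseIndepBinning (law i))
    {q : (∀ i, X i) → ℝ} (hq : ∀ m, 0 ≤ q m) {D : ℝ} (hD : ∑ m, q m ≤ D)
    {β : Finset ι → ℝ} (hβ0 : ∀ S, 0 ≤ β S)
    (hβ : ∀ S : Finset ι, S.Nonempty → ∀ m, q m ≠ 0 →
      ∑ m', q m' * (if ∀ i ∈ S, m i = m' i then 1 else 0) ≤ D * β S)
    (y : ∀ i, Y i) :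
    ∑ B, lawWeight law B *
        (∑ m, q m * hit B m y - (∑ m, q m) * ∏ i, (1 / Fintype.card (Y i) : ℝ)) ^ 2 ≤
      ((∏ i, (1 / Fintype.card (Y i) : ℝ)) * D) ^ 2 *
        ∑ S : Finset ι with S.Nonempty, (∏ i ∈ S, (Fintype.card (Y i) : ℝ)) * β S := by
  set u : ℝ := ∏ i, (1 / Fintype.card (Y i) : ℝ) with hu'
  set Q := ∑ m, q m with hQ
  have hQ0 : 0 ≤ Q := Finset.sum_nonneg fun m _ => hq m
  have hsq : ∑ B, lawWeight law B * (∑ m, q m * hit B m y) ^ 2 =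
      u ^ 2 * ∑ m, ∑ m', q m * (q m' *
        ∏ i, if m i = m' i then (Fintype.card (Y i) : ℝ) else 1) := by
    simp_rw [sq (∑ m, q m * hit _ m y), Finset.sum_mul_sum, Finset.mul_sum]
    rw [Finset.sum_comm]
    refine Finset.sum_congr rfl fun m _ => ?_
    rw [Finset.sum_comm]
    refine Finset.sum_congr rfl fun m' _ => ?_
    calc _ = q m * q m' * ∑ B, lawWeight law B * (hit B m y * hit B m' y) := by
          rw [Finset.mul_sum]
          exact Finset.sum_congr rfl fun B _ => by ring
      _ = _ := by
          rw [sum_lawWeight_mul_hit_mul_hit hu hp]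
          ring
  have hlin : ∑ B, lawWeight law B * ∑ m, q m * hit B m y = Q * u := by
    simp_rw [Finset.mul_sum]
    rw [Finset.sum_comm, hQ, Finset.sum_mul]
    refine Finset.sum_congr rfl fun m _ => ?_
    rw [hu', ← sum_lawWeight_mul_hit hu m y, Finset.mul_sum]
    exact Finset.sum_congr rfl fun B _ => by ring
  have hvar : ∑ B, lawWeight law B * (∑ m, q m * hit B m y - Q * u) ^ 2 =
      u ^ 2 * ∑ m, q m * ∑ m', q m' *
        ((∏ i, if m i = m' i then (Fintype.card (Y i) : ℝ) else 1) - 1) := by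
    calc _ = ∑ B, lawWeight law B * (∑ m, q m * hit B m y) ^ 2
          - 2 * (Q * u) * ∑ B, lawWeight law B * ∑ m, q m * hit B m y
          + (Q * u) ^ 2 * ∑ B, lawWeight law B := by
          rw [Finset.mul_sum, Finset.mul_sum, ← Finset.sum_sub_distrib, ← Finset.sum_add_distrib]
          exact Finset.sum_congr rfl fun B _ => by ring
      _ = _ := by
          rw [hlin, hsq, sum_lawWeight]
          simp_rw [mul_sub, Finset.sum_sub_distrib, ← Finset.mul_sum, mul_one, mul_sub,
            Finset.sum_sub_distrib, ← Finset.sum_mul]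
          ring
  rw [hvar, mul_pow, mul_assoc]
  refine mul_le_mul_of_nonneg_left ?_ (sq_nonneg u)
  have hrow : ∀ m, q m * ∑ m', q m' *
        ((∏ i, if m i = m' i then (Fintype.card (Y i) : ℝ) else 1) - 1) ≤
      q m * (D * ∑ S : Finset ι with S.Nonempty, (∏ i ∈ S, (Fintype.card (Y i) : ℝ)) * β S) := by
    intro m
    rcases eq_or_ne (q m) 0 with h0 | h0
    · simp [h0]
    refine mul_le_mul_of_nonneg_left ?_ (hq m)
    calc _ ≤ ∑ m', q m' * ∑ S : Finset ι with S.Nonempty,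
            (∏ i ∈ S, (Fintype.card (Y i) : ℝ)) * if ∀ i ∈ S, m i = m' i then 1 else 0 :=
          Finset.sum_le_sum fun m' _ =>
            mul_le_mul_of_nonneg_left (prod_ite_sub_one_le m m') (hq m')
      _ = ∑ S : Finset ι with S.Nonempty, (∏ i ∈ S, (Fintype.card (Y i) : ℝ)) *
            ∑ m', q m' * if ∀ i ∈ S, m i = m' i then 1 else 0 := by
          simp_rw [Finset.mul_sum]
          rw [Finset.sum_comm]
          exact Finset.sum_congr rfl fun S _ => Finset.sum_congr rfl fun m' _ => by ring
      _ ≤ ∑ S : Finset ι with S.Nonempty, (∏ i ∈ S, (Fintype.card (Y i) : ℝ)) * (D * β S) :=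
          Finset.sum_le_sum fun S hS => mul_le_mul_of_nonneg_left
            (hβ S (Finset.mem_filter.1 hS).2 m h0)
            (Finset.prod_nonneg fun _ _ => Nat.cast_nonneg _)
      _ = _ := by
          rw [Finset.mul_sum]
          exact Finset.sum_congr rfl fun S _ => by ring
  refine (Finset.sum_le_sum fun m _ => hrow m).trans ?_
  rw [← Finset.sum_mul, sq, mul_assoc]
  have hD0 : 0 ≤ D := hQ0.trans hD
  refine mul_le_mul_of_nonneg_right hD (mul_nonneg hD0 (Finset.sum_nonneg fun S _ =>
    mul_nonneg (Finset.prod_nonneg fun _ _ => Nat.cast_nonneg _) (hβ0 S)))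

/-- The expected `L¹` distance between the binned mass function `q` and the uniform one. -/
theorem sum_expected_abs_le [∀ i, Nonempty (Y i)] {law : ∀ i, PMF (X i → Y i)}
    (hu : ∀ i, IsUniformBinning (law i)) (hp : ∀ i, IsPairwiseIndepBinning (law i))
    {q : (∀ i, X i) → ℝ} (hq : ∀ m, 0 ≤ q m) {D : ℝ} (hD : ∑ m, q m ≤ D)
    {β : Finset ι → ℝ} (hβ0 : ∀ S, 0 ≤ β S)
    (hβ : ∀ S : Finset ι, S.Nonempty → ∀ m, q m ≠ 0 →
      ∑ m', q m' * (if ∀ i ∈ S, m i = m' i then 1 else 0) ≤ D * β S) :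
    ∑ y, ∑ B, lawWeight law B *
        |∑ m, q m * hit B m y - (∑ m, q m) * ∏ i, (1 / Fintype.card (Y i) : ℝ)| ≤
      D * √(∑ S : Finset ι with S.Nonempty, (∏ i ∈ S, (Fintype.card (Y i) : ℝ)) * β S) := by
  have hD0 : 0 ≤ D := (Finset.sum_nonneg fun m _ => hq m).trans hD
  have hu0 : 0 ≤ ∏ i, (1 / Fintype.card (Y i) : ℝ) := Finset.prod_nonneg fun _ _ => by positivity
  have key : ∀ y : ∀ i, Y i, ∑ B, lawWeight law B *
        |∑ m, q m * hit B m y - (∑ m, q m) * ∏ i, (1 / Fintype.card (Y i) : ℝ)| ≤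
      (∏ i, (1 / Fintype.card (Y i) : ℝ)) * D *
        √(∑ S : Finset ι with S.Nonempty, (∏ i ∈ S, (Fintype.card (Y i) : ℝ)) * β S) := by
    intro y
    rw [← Real.sqrt_sq (mul_nonneg hu0 hD0), ← Real.sqrt_mul (sq_nonneg _)]
    refine Real.le_sqrt_of_sq_le (le_trans ?_ (variance_le hu hp hq hD hβ0 hβ y))
    have := Finset.sum_sq_le_sum_mul_sum_of_sq_le_mul Finset.univ
      (f := fun B => lawWeight law B)
      (g := fun B => lawWeight law B *
        (∑ m, q m * hit B m y - (∑ m, q m) * ∏ i, (1 / Fintype.card (Y i) : ℝ)) ^ 2)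
      (r := fun B => lawWeight law B *
        |∑ m, q m * hit B m y - (∑ m, q m) * ∏ i, (1 / Fintype.card (Y i) : ℝ)|)
      (fun B _ => lawWeight_nonneg law B)
      (fun B _ => mul_nonneg (lawWeight_nonneg law B) (sq_nonneg _))
      (fun B _ => by rw [mul_pow, sq_abs]; exact le_of_eq (by ring))
    rwa [sum_lawWeight, one_mul] at this
  refine (Finset.sum_le_sum fun y _ => key y).trans_eq ?_
  rw [Finset.sum_const, Finset.card_univ, nsmul_eq_mul, ← mul_assoc, ← mul_assoc,
    card_pi_mul_prod, one_mul]

end OneShot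

/-! ### Random affine maps -/

section Linear

variable {F : Type*} [Field F] [Fintype F] [DecidableEq F]

/-- A surjective homomorphism between finite groups pushes the uniform measure to the uniform
measure, all its fibres being equally large. -/
theorem uniform_fiber {G H : Type*} [AddGroup G] [AddGroup H] [Fintype G] [Fintype H]
    (f : G →+ H) (hf : Function.Surjective f) (h : H) :
    ((PMF.uniformOfFintype G).toOuterMeasure {g | f g = h}).toReal =
      1 / (Fintype.card H : ℝ) := by
  classical
  rw [toReal_toOuterMeasure_apply]
  simp only [PMF.uniformOfFintype_apply, ENNReal.toReal_inv, ENNReal.toReal_natCast,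
    ← Finset.mul_sum, Finset.sum_boole]
  have hfib : ∀ h', (Finset.univ.filter fun g => f g = h').card =
      (Finset.univ.filter fun g => f g = h).card := fun h' =>
    AddMonoidHom.card_fiber_eq_of_mem_range f (hf h') (hf h)
  have hcard : Fintype.card G =
      Fintype.card H * (Finset.univ.filter fun g => f g = h).card := by
    rw [← Finset.card_univ, Finset.card_eq_sum_card_fiberwise (f := f) (t := Finset.univ)
      (fun _ _ => Finset.mem_coe.2 (Finset.mem_univ _)), Finset.sum_congr rfl fun h' _ => hfib h']
    simp
  have hG : (Fintype.card G : ℝ) ≠ 0 := Nat.cast_ne_zero.2 Fintype.card_ne_zero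
  have hH : (Fintype.card H : ℝ) ≠ 0 := Nat.cast_ne_zero.2 Fintype.card_ne_zero
  have hcard' := congrArg (Nat.cast : ℕ → ℝ) hcard
  push_cast at hcard'
  field_simp
  linarith

/-- Evaluation of the affine map with coefficients `(A, V)` at a point, as a homomorphism in
`(A, V)`. -/
def affineEval {n l k : ℕ} (x : Fin n → Fin l → F) :
    (Matrix (Fin k) (Fin n × Fin l) F × (Fin k → F)) →+ (Fin k → F) where
  toFun AV := affineBinning AV.1 AV.2 x
  map_zero' := by simp [affineBinning]
  map_add' AV AV' := by
    simp only [affineBinning, Prod.fst_add, Prod.snd_add, Matrix.add_mulVec]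
    abel

theorem isUniformBinning_linearBinningLaw (n l k : ℕ) :
    IsUniformBinning (linearBinningLaw F n l k) := by
  intro x y
  rw [linearBinningLaw, PMF.toOuterMeasure_map_apply]
  refine uniform_fiber (affineEval x) (fun y => ⟨(0, y), ?_⟩) y
  simp [affineEval, affineBinning]

theorem isPairwiseIndepBinning_linearBinningLaw (n l k : ℕ) :
    IsPairwiseIndepBinning (linearBinningLaw F n l k) := by
  intro x x' hx y y'
  rw [linearBinningLaw, PMF.toOuterMeasure_map_apply]
  obtain ⟨a, b, hab⟩ : ∃ a b, x a b ≠ x' a b := by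
    by_contra! h
    exact hx (funext fun a => funext fun b => h a b)
  have hsurj : Function.Surjective
      ((affineEval (k := k) x).prod (affineEval (k := k) x')) := by
    rintro ⟨z, z'⟩
    -- a rank one matrix sends `x - x'` to `z - z'`, and the shift then corrects the value at `x`
    set A : Matrix (Fin k) (Fin n × Fin l) F :=
      Matrix.vecMulVec (z - z') (Pi.single (a, b) (x a b - x' a b)⁻¹) with hA
    have hAv : ∀ v : Fin n → Fin l → F, A.mulVec (fun s => v s.1 s.2) =
        ((x a b - x' a b)⁻¹ * v a b) • (z - z') := by
      intro v
      rw [hA, Matrix.vecMulVec_mulVec, single_dotProduct]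
      ext i
      simp [mul_comm]
    refine ⟨(A, z - A.mulVec fun s => x s.1 s.2), ?_⟩
    have hne : x a b - x' a b ≠ 0 := sub_ne_zero.2 hab
    refine Prod.ext ?_ ?_
    · simp [affineEval, affineBinning]
    · ext i
      simp only [affineEval, affineBinning, AddMonoidHom.prod_apply, AddMonoidHom.coe_mk,
        ZeroHom.coe_mk, hAv, Pi.add_apply, Pi.sub_apply, Pi.smul_apply, smul_eq_mul]
      field_simp
      ring
  have := uniform_fiber _ hsurj (y, y')
  rw [Fintype.card_prod, Nat.cast_mul, ← sq] at this
  rw [← this]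
  congr 2
  ext AV
  simp [affineEval, Prod.ext_iff]

end Linear

/-! ### The memoryless source -/

section Source

variable {t : ℕ} {M : Fin t → Type*} {C : Type*}

/-- The conditional probability `p(m_S | c)`, with value `0` where `p(c) = 0`. -/
noncomputable def condProb (p : PMF ((∀ i, M i) × C)) (S : Finset (Fin t))
    (x : (∀ i, M i) × C) : ℝ :=
  (subsetPmf p S (fun i => x.1 i, x.2)).toReal / ((subsetPmf p S).map Prod.snd x.2).toReal

theorem map_snd_subsetPmf (p : PMF ((∀ i, M i) × C)) (S : Finset (Fin t)) :
    (subsetPmf p S).map Prod.snd = p.map Prod.snd := by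
  rw [subsetPmf, PMF.map_comp]
  rfl

theorem iidPmf_nonneg (p : PMF ((∀ i, M i) × C)) (n : ℕ) (m : ∀ i, Fin n → M i)
    (c : Fin n → C) : 0 ≤ iidPmf p n m c :=
  Finset.prod_nonneg fun _ _ => ENNReal.toReal_nonneg

theorem condProb_nonneg (p : PMF ((∀ i, M i) × C)) (S : Finset (Fin t))
    (x : (∀ i, M i) × C) : 0 ≤ condProb p S x :=
  div_nonneg ENNReal.toReal_nonneg ENNReal.toReal_nonneg

variable [∀ i, Fintype (M i)]

/-- Summing a product over the repetitions factorises, with `m` indexed by variable first and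
repetition second. -/
theorem sum_prod_swap {n : ℕ} (f : Fin n → (∀ i, M i) → ℝ) :
    ∑ m : ∀ i, Fin n → M i, ∏ j, f j (fun i => m i j) = ∏ j, ∑ v, f j v := by
  classical
  rw [Fintype.prod_sum]
  exact Fintype.sum_equiv (Equiv.piComm fun i (_ : Fin n) => M i) _ _ fun m => rfl

/-- Replacing the source by the truncation `q` costs at most twice the removed mass in `L¹`. -/
theorem sum_abs_binned_sub_le {Y : Fin t → Type*} [∀ i, Fintype (Y i)] [∀ i, Nonempty (Y i)]
    [∀ i, DecidableEq (Y i)] {n : ℕ} (p : PMF ((∀ i, M i) × C))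
    {q : (Fin n → C) → (∀ i, Fin n → M i) → ℝ} (hq : ∀ c m, q c m ≤ iidPmf p n m c)
    (B : ∀ i, (Fin n → M i) → Y i) (c : Fin n → C) :
    ∑ y, |binnedPmf p n B c y - idealPmf p n c y| ≤
      ∑ y, |∑ m, q c m * hit B m y - (∑ m, q c m) * ∏ i, (1 / Fintype.card (Y i) : ℝ)| +
        2 * ∑ m, (iidPmf p n m c - q c m) := by
  set u : ℝ := ∏ i, (1 / Fintype.card (Y i) : ℝ) with hu
  have hu0 : 0 ≤ u := Finset.prod_nonneg fun _ _ => by positivity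
  have hr : ∀ m, 0 ≤ iidPmf p n m c - q c m := fun m => sub_nonneg.2 (hq c m)
  have hid : ∀ y : ∀ i, Y i, idealPmf p n c y = (∑ m, iidPmf p n m c) * u := fun y => by
    simp [idealPmf, hu]
  have hpt : ∀ y : ∀ i, Y i, |binnedPmf p n B c y - idealPmf p n c y| ≤
      |∑ m, q c m * hit B m y - (∑ m, q c m) * u| +
        (∑ m, (iidPmf p n m c - q c m) * hit B m y +
          (∑ m, (iidPmf p n m c - q c m)) * u) := by
    intro y
    have h1 : 0 ≤ ∑ m, (iidPmf p n m c - q c m) * hit B m y :=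
      Finset.sum_nonneg fun m _ => mul_nonneg (hr m) (hit_nonneg B m y)
    have h2 : 0 ≤ (∑ m, (iidPmf p n m c - q c m)) * u :=
      mul_nonneg (Finset.sum_nonneg fun m _ => hr m) hu0
    have heq : binnedPmf p n B c y - idealPmf p n c y =
        (∑ m, q c m * hit B m y - (∑ m, q c m) * u) +
          (∑ m, (iidPmf p n m c - q c m) * hit B m y -
            (∑ m, (iidPmf p n m c - q c m)) * u) := by
      rw [hid, binnedPmf]
      simp only [sub_mul, Finset.sum_sub_distrib, hit]
      ring
    rw [heq]
    refine (abs_add_le _ _).trans (add_le_add le_rfl ?_)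
    rw [abs_le]
    constructor <;> linarith
  refine (Finset.sum_le_sum fun y _ => hpt y).trans_eq ?_
  rw [Finset.sum_add_distrib, Finset.sum_add_distrib, Finset.sum_comm (γ := ∀ i, Y i),
    Finset.sum_const, Finset.card_univ, nsmul_eq_mul]
  simp_rw [← Finset.mul_sum, sum_hit, mul_one]
  rw [mul_left_comm, hu, card_pi_mul_prod]
  ring

variable [Fintype C]

theorem subsetPmf_eq_condProb_mul (p : PMF ((∀ i, M i) × C)) (S : Finset (Fin t))
    (x : (∀ i, M i) × C) :
    (subsetPmf p S (fun i => x.1 i, x.2)).toReal =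
      condProb p S x * (p.map Prod.snd x.2).toReal := by
  classical
  rw [condProb, map_snd_subsetPmf]
  refine (div_mul_cancel_of_imp fun h => ?_).symm
  rw [← map_snd_subsetPmf p S, toReal_map_apply,
    Finset.sum_eq_zero_iff_of_nonneg fun a _ => by split_ifs <;> simp] at h
  simpa using h (fun i => x.1 i, x.2) (Finset.mem_univ _)

theorem sum_mul_log_condProb (p : PMF ((∀ i, M i) × C)) (S : Finset (Fin t)) :
    ∑ x, (p x).toReal * Real.log (condProb p S x) =
      -(condEntropy (subsetPmf p S) * Real.log 2) := by
  have hlog : Real.log 2 ≠ 0 := (Real.log_pos one_lt_two).ne'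
  rw [condEntropy, neg_mul, neg_neg, ← Fintype.sum_prod_type', Finset.sum_mul]
  have := sum_toReal_map_mul p (fun x => ((fun i : S => x.1 i, x.2) : (∀ i : S, M i) × C))
    fun z => Real.log ((subsetPmf p S z).toReal / ((subsetPmf p S).map Prod.snd z.2).toReal)
  refine this.symm.trans (Finset.sum_congr rfl fun z _ => ?_)
  rw [Real.logb, mul_assoc, div_mul_cancel₀ _ hlog]
  rfl

theorem map_snd_toReal (p : PMF ((∀ i, M i) × C)) (c : C) :
    (p.map Prod.snd c).toReal = ∑ v, (p (v, c)).toReal := by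
  classical
  rw [toReal_map_apply, Fintype.sum_prod_type]
  simp

theorem sum_iidPmf (p : PMF ((∀ i, M i) × C)) (n : ℕ) (c : Fin n → C) :
    ∑ m, iidPmf p n m c = ∏ j, (p.map Prod.snd (c j)).toReal := by
  simp_rw [map_snd_toReal]
  exact sum_prod_swap fun j v => (p (v, c j)).toReal

/-- `p(m_S^n, c^n)`, obtained by summing over all `m'` that agree with `m` on `S`, is again a
product over the repetitions. -/
theorem sum_iidPmf_agree [∀ i, DecidableEq (M i)] (p : PMF ((∀ i, M i) × C)) (n : ℕ)
    (S : Finset (Fin t)) (m : ∀ i, Fin n → M i) (c : Fin n → C) :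
    ∑ m', iidPmf p n m' c * (if ∀ i ∈ S, m i = m' i then 1 else 0) =
      ∏ j, (subsetPmf p S (fun i => m i j, c j)).toReal := by
  classical
  have hfac : ∀ j, (subsetPmf p S (fun i => m i j, c j)).toReal =
      ∑ v : ∀ i, M i, (p (v, c j)).toReal * if ∀ i ∈ S, m i j = v i then 1 else 0 := by
    intro j
    rw [subsetPmf, toReal_map_apply, Fintype.sum_prod_type]
    refine Finset.sum_congr rfl fun v _ => ?_
    rw [Finset.sum_eq_single (c j) (fun c' _ hc => if_neg fun h => hc (Prod.ext_iff.1 h).2)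
      fun h => absurd (Finset.mem_univ _) h]
    simp only [Prod.mk.injEq, and_true, mul_ite, mul_one, mul_zero, funext_iff, Subtype.forall,
      eq_comm]
  simp_rw [hfac]
  rw [← sum_prod_swap fun j v => (p (v, c j)).toReal * if ∀ i ∈ S, m i j = v i then 1 else 0]
  refine Finset.sum_congr rfl fun m' _ => ?_
  rw [Finset.prod_mul_distrib, iidPmf, Finset.prod_boole]
  congr 1
  simp only [funext_iff, Finset.mem_univ, true_imp_iff]
  exact if_congr ⟨fun h j i hi => h i hi j, fun h i hi j => h j i hi⟩ rfl rfl

/-- Pairs `(c^n, m^n)` are re-read as sequences of `n` source symbols. -/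
theorem sum_iidPmf_mul (p : PMF ((∀ i, M i) × C)) (n : ℕ)
    (φ : (Fin n → (∀ i, M i) × C) → ℝ) :
    ∑ c, ∑ m, iidPmf p n m c * φ (fun j => (fun i => m i j, c j)) =
      ∑ x : Fin n → (∀ i, M i) × C, (∏ j, (p (x j)).toReal) * φ x := by
  rw [← Fintype.sum_prod_type']
  let e : (Fin n → C) × (∀ i, Fin n → M i) ≃ (Fin n → (∀ i, M i) × C) :=
    { toFun := fun z j => (fun i => z.2 i j, z.1 j)
      invFun := fun x => (fun j => (x j).2, fun i j => (x j).1 i)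
      left_inv := fun _ => rfl
      right_inv := fun _ => rfl }
  exact Fintype.sum_equiv e _ _ fun _ => rfl

theorem sum_sum_iidPmf (p : PMF ((∀ i, M i) × C)) (n : ℕ) :
    ∑ c, ∑ m, iidPmf p n m c = 1 := by
  have := sum_iidPmf_mul p n fun _ => 1
  simp only [mul_one] at this
  rw [this, ← Fintype.sum_pow (fun x => (p x).toReal), sum_toReal_eq_one, one_pow]

/-! ### Expected distance -/

section Bound

variable [∀ i, DecidableEq (M i)] {Y : Fin t → Type*} [∀ i, Fintype (Y i)]
  [∀ i, Nonempty (Y i)] [∀ i, DecidableEq (Y i)]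

theorem expectedDistance_nonneg (p : PMF ((∀ i, M i) × C)) (n : ℕ)
    (law : ∀ i, PMF ((Fin n → M i) → Y i)) : 0 ≤ expectedDistance p n law :=
  Finset.sum_nonneg fun B _ => mul_nonneg (lawWeight_nonneg law B)
    (mul_nonneg (by norm_num) (Finset.sum_nonneg fun _ _ => abs_nonneg _))

/-- The nonasymptotic bound: `q` is a truncation of the source, on whose support
`p(m_S^n | c^n) ≤ β S`. -/
theorem expectedDistance_le {n : ℕ} (p : PMF ((∀ i, M i) × C))
    {law : ∀ i, PMF ((Fin n → M i) → Y i)}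
    (hu : ∀ i, IsUniformBinning (law i)) (hp : ∀ i, IsPairwiseIndepBinning (law i))
    {q : (Fin n → C) → (∀ i, Fin n → M i) → ℝ} (hq0 : ∀ c m, 0 ≤ q c m)
    (hq : ∀ c m, q c m ≤ iidPmf p n m c) {β : Finset (Fin t) → ℝ} (hβ0 : ∀ S, 0 ≤ β S)
    (hβ : ∀ S : Finset (Fin t), S.Nonempty → ∀ c m, q c m ≠ 0 →
      ∑ m', iidPmf p n m' c * (if ∀ i ∈ S, m i = m' i then 1 else 0) ≤
        (∑ m, iidPmf p n m c) * β S) :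
    expectedDistance p n law ≤
      1 / 2 * √(∑ S : Finset (Fin t) with S.Nonempty,
        (∏ i ∈ S, (Fintype.card (Y i) : ℝ)) * β S) +
      ∑ c, ∑ m, (iidPmf p n m c - q c m) := by
  set E := √(∑ S : Finset (Fin t) with S.Nonempty, (∏ i ∈ S, (Fintype.card (Y i) : ℝ)) * β S)
  have hc : ∀ c, ∑ B, lawWeight law B * ∑ y, |binnedPmf p n B c y - idealPmf p n c y| ≤
      (∑ m, iidPmf p n m c) * E + 2 * ∑ m, (iidPmf p n m c - q c m) := by
    intro c
    calc _ ≤ ∑ B, lawWeight law B * (∑ y, |∑ m, q c m * hit B m y -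
            (∑ m, q c m) * ∏ i, (1 / Fintype.card (Y i) : ℝ)| +
              2 * ∑ m, (iidPmf p n m c - q c m)) :=
          Finset.sum_le_sum fun B _ => mul_le_mul_of_nonneg_left
            (sum_abs_binned_sub_le p hq B c) (lawWeight_nonneg law B)
      _ = ∑ y, ∑ B, lawWeight law B * |∑ m, q c m * hit B m y -
            (∑ m, q c m) * ∏ i, (1 / Fintype.card (Y i) : ℝ)| +
              2 * ∑ m, (iidPmf p n m c - q c m) := by
          simp_rw [mul_add, Finset.sum_add_distrib, ← Finset.sum_mul, sum_lawWeight, one_mul,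
            Finset.mul_sum]
          rw [Finset.sum_comm]
      _ ≤ _ := by
          refine add_le_add (sum_expected_abs_le hu hp (hq0 c)
            (Finset.sum_le_sum fun m _ => hq c m) hβ0 fun S hS m hm =>
              (Finset.sum_le_sum fun m' _ => ?_).trans (hβ S hS c m hm)) le_rfl
          by_cases h : ∀ i ∈ S, m i = m' i
          · rw [if_pos h, if_pos h, mul_one, mul_one]
            exact hq c m'
          · rw [if_neg h, if_neg h, mul_zero, mul_zero]
  have hsum := Finset.sum_le_sum fun c (_ : c ∈ Finset.univ) => hc c
  rw [Finset.sum_add_distrib, ← Finset.sum_mul, sum_sum_iidPmf, one_mul, ← Finset.mul_sum] at hsum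
  have heq : expectedDistance p n law =
      1 / 2 * ∑ c, ∑ B, lawWeight law B * ∑ y, |binnedPmf p n B c y - idealPmf p n c y| := by
    rw [Finset.sum_comm, Finset.mul_sum]
    refine Finset.sum_congr rfl fun B _ => ?_
    rw [totalVariation, Fintype.sum_prod_type, ← Finset.mul_sum, lawWeight]
    ring
  rw [heq]
  linarith

end Bound

/-! ### Typical sequences -/

/-- One-sided conditional typicality: `∑ j, log p(m_{S,j} | c_j) ≤ -n a_S` for all nonempty `S`.
Since `Real.log 0 = 0`, this implies `p(m_S^n | c^n) ≤ exp (-n a_S)` also for sequences of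
probability zero. -/
def IsTypical (p : PMF ((∀ i, M i) × C)) (a : Finset (Fin t) → ℝ) {n : ℕ}
    (x : Fin n → (∀ i, M i) × C) : Prop :=
  ∀ S : Finset (Fin t), S.Nonempty → ∑ j, Real.log (condProb p S (x j)) ≤ n * -a S

theorem sum_agree_le_of_isTypical [∀ i, DecidableEq (M i)] {p : PMF ((∀ i, M i) × C)}
    {a : Finset (Fin t) → ℝ} {n : ℕ} {m : ∀ i, Fin n → M i} {c : Fin n → C}
    (h : IsTypical p a fun j => (fun i => m i j, c j)) {S : Finset (Fin t)} (hS : S.Nonempty) :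
    ∑ m', iidPmf p n m' c * (if ∀ i ∈ S, m i = m' i then 1 else 0) ≤
      (∑ m, iidPmf p n m c) * Real.exp (n * -a S) := by
  rw [sum_iidPmf_agree, sum_iidPmf,
    Finset.prod_congr rfl fun j _ => subsetPmf_eq_condProb_mul p S (fun i => m i j, c j),
    Finset.prod_mul_distrib, mul_comm]
  refine mul_le_mul_of_nonneg_left ?_ (Finset.prod_nonneg fun _ _ => ENNReal.toReal_nonneg)
  calc _ ≤ ∏ j, Real.exp (Real.log (condProb p S (fun i => m i j, c j))) :=
        Finset.prod_le_prod (fun j _ => condProb_nonneg p S _) fun j _ => Real.le_exp_log _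
    _ ≤ _ := by
        rw [← Real.exp_sum]
        exact Real.exp_le_exp.2 (h S hS)

open Classical in
/-- The probability of the atypical sequences decays exponentially. -/
theorem exists_atypical_rate (p : PMF ((∀ i, M i) × C)) (a : Finset (Fin t) → ℝ)
    (ha : ∀ S : Finset (Fin t), S.Nonempty →
      a S < condEntropy (subsetPmf p S) * Real.log 2) :
    ∃ r : Finset (Fin t) → ℝ, (∀ S, S.Nonempty → 0 ≤ r S ∧ r S < 1) ∧ ∀ n : ℕ,
      ∑ c, ∑ m, (iidPmf p n m c -
        if IsTypical p a fun j => (fun i => m i j, c j) then iidPmf p n m c else 0) ≤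
      ∑ S : Finset (Fin t) with S.Nonempty, r S ^ n := by
  have hex : ∀ S : Finset (Fin t), ∃ r : ℝ, S.Nonempty → 0 ≤ r ∧ r < 1 ∧ ∀ n : ℕ,
      ∑ x : Fin n → (∀ i, M i) × C, (∏ j, (p (x j)).toReal) *
        (if n * -a S < ∑ j, Real.log (condProb p S (x j)) then 1 else 0) ≤ r ^ n := by
    intro S
    by_cases hS : S.Nonempty
    · obtain ⟨r, h0, h1, h2⟩ := exists_chernoff_rate (fun x => (p x).toReal)
        (fun x => Real.log (condProb p S x)) (fun _ => ENNReal.toReal_nonneg)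
        (sum_toReal_eq_one p) (b := -a S) (by
          rw [sum_mul_log_condProb]
          exact neg_lt_neg (ha S hS))
      exact ⟨r, fun _ => ⟨h0, h1, h2⟩⟩
    · exact ⟨0, fun h => absurd h hS⟩
  choose r hr using hex
  refine ⟨r, fun S hS => ⟨(hr S hS).1, (hr S hS).2.1⟩, fun n => ?_⟩
  calc _ = ∑ x : Fin n → (∀ i, M i) × C, (∏ j, (p (x j)).toReal) *
          (if IsTypical p a x then 0 else 1) := by
        rw [← sum_iidPmf_mul]
        refine Finset.sum_congr rfl fun c _ => Finset.sum_congr rfl fun m _ => ?_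
        split_ifs <;> simp
    _ ≤ ∑ x : Fin n → (∀ i, M i) × C, (∏ j, (p (x j)).toReal) *
          ∑ S : Finset (Fin t) with S.Nonempty,
            (if n * -a S < ∑ j, Real.log (condProb p S (x j)) then 1 else 0) := by
        refine Finset.sum_le_sum fun x _ => mul_le_mul_of_nonneg_left ?_
          (Finset.prod_nonneg fun _ _ => ENNReal.toReal_nonneg)
        have hnn : ∀ S ∈ Finset.univ.filter (Finset.Nonempty (α := Fin t)),
            (0 : ℝ) ≤ if n * -a S < ∑ j, Real.log (condProb p S (x j)) then 1 else 0 :=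
          fun S _ => by split_ifs <;> norm_num
        split_ifs with h
        · exact Finset.sum_nonneg hnn
        · simp only [IsTypical, not_forall, not_le] at h
          obtain ⟨S, hS, hlt⟩ := h
          refine le_trans ?_ (Finset.single_le_sum hnn
            (Finset.mem_filter.2 ⟨Finset.mem_univ S, hS⟩))
          rw [if_pos hlt]
    _ = ∑ S : Finset (Fin t) with S.Nonempty,
          ∑ x : Fin n → (∀ i, M i) × C, (∏ j, (p (x j)).toReal) *
            (if n * -a S < ∑ j, Real.log (condProb p S (x j)) then 1 else 0) := by
        simp_rw [Finset.mul_sum]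
        rw [Finset.sum_comm]
    _ ≤ _ := Finset.sum_le_sum fun S hS => (hr S (Finset.mem_filter.1 hS).2).2.2 n

/-! ### Convergence -/

/-- Output statistics of random binning for arbitrary finite alphabets. -/
theorem tendsto_expectedDistance [∀ i, DecidableEq (M i)] {Y : ℕ → Fin t → Type*}
    [∀ n i, Fintype (Y n i)] [∀ n i, Nonempty (Y n i)] [∀ n i, DecidableEq (Y n i)]
    (p : PMF ((∀ i, M i) × C)) (a : Finset (Fin t) → ℝ)
    (ha : ∀ S : Finset (Fin t), S.Nonempty →
      a S < condEntropy (subsetPmf p S) * Real.log 2)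
    (hY : ∀ S : Finset (Fin t), S.Nonempty →
      Tendsto (fun n : ℕ => (∏ i ∈ S, (Fintype.card (Y n i) : ℝ)) * Real.exp (n * -a S))
        atTop (𝓝 0))
    (law : ∀ n i, PMF ((Fin n → M i) → Y n i))
    (hu : ∀ n i, IsUniformBinning (law n i)) (hp : ∀ n i, IsPairwiseIndepBinning (law n i)) :
    Tendsto (fun n : ℕ => expectedDistance p n (law n)) atTop (𝓝 0) := by
  classical
  obtain ⟨r, hr, hrn⟩ := exists_atypical_rate p a ha
  refine squeeze_zero (fun n => expectedDistance_nonneg p n (law n))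
    (g := fun n => 1 / 2 * √(∑ S : Finset (Fin t) with S.Nonempty,
      (∏ i ∈ S, (Fintype.card (Y n i) : ℝ)) * Real.exp (n * -a S)) +
        ∑ S : Finset (Fin t) with S.Nonempty, r S ^ n) (fun n => ?_) ?_
  · refine (expectedDistance_le p (hu n) (hp n)
      (q := fun c m => if IsTypical p a fun j => (fun i => m i j, c j) then iidPmf p n m c else 0)
      (fun c m => ?_) (fun c m => ?_) (fun S => (Real.exp_pos _).le)
      fun S hS c m hm => ?_).trans (add_le_add le_rfl (hrn n))
    · split_ifs
      · exact iidPmf_nonneg p n m c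
      · exact le_rfl
    · split_ifs
      · exact le_rfl
      · exact iidPmf_nonneg p n m c
    · exact sum_agree_le_of_isTypical (by_contra fun h => hm (if_neg h)) hS
  · have h1 : Tendsto (fun n : ℕ => ∑ S : Finset (Fin t) with S.Nonempty,
        (∏ i ∈ S, (Fintype.card (Y n i) : ℝ)) * Real.exp (n * -a S)) atTop (𝓝 0) := by
      simpa using tendsto_finsetSum (Finset.univ.filter (Finset.Nonempty (α := Fin t)))
        fun S hS => hY S (Finset.mem_filter.1 hS).2
    have h2 : Tendsto (fun n : ℕ => ∑ S : Finset (Fin t) with S.Nonempty, r S ^ n)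
        atTop (𝓝 0) := by
      simpa using tendsto_finsetSum (Finset.univ.filter (Finset.Nonempty (α := Fin t)))
        fun S hS => tendsto_pow_atTop_nhds_zero_of_lt_one (hr S (Finset.mem_filter.1 hS).2).1
          (hr S (Finset.mem_filter.1 hS).2).2
    simpa only [Real.sqrt_zero, mul_zero, add_zero] using (h1.sqrt.const_mul (1 / 2)).add h2

end Source

/-- If the numbers `k n i` of output symbols have rates `R i`, in bits, whose sum over `S` stays
below `a / log 2`, then the number of bin tuples over `S` is `o(exp (n a))`. -/
theorem tendsto_prod_card_mul_exp {F ι : Type*} [Field F] [Fintype F] {R : ι → ℝ}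
    {k : ℕ → ι → ℕ}
    (hk : ∀ i, Tendsto (fun n : ℕ => (k n i : ℝ) * Real.logb 2 (Fintype.card F) / n)
      atTop (𝓝 (R i))) {S : Finset ι} {a : ℝ} (ha : (∑ i ∈ S, R i) * Real.log 2 < a) :
    Tendsto (fun n : ℕ => (∏ i ∈ S, (Fintype.card (Fin (k n i) → F) : ℝ)) * Real.exp (n * -a))
      atTop (𝓝 0) := by
  have hlog : Real.log 2 ≠ 0 := (Real.log_pos one_lt_two).ne'
  have hF : (0 : ℝ) < Fintype.card F := Nat.cast_pos.2 Fintype.card_pos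
  have hlim : Tendsto (fun n : ℕ =>
      (∑ i ∈ S, (k n i : ℝ) * Real.logb 2 (Fintype.card F) / n) * Real.log 2 - a) atTop
      (𝓝 ((∑ i ∈ S, R i) * Real.log 2 - a)) :=
    ((tendsto_finsetSum S fun i _ => hk i).mul_const _).sub_const a
  have hexp := Real.tendsto_exp_atBot.comp
    (tendsto_natCast_atTop_atTop.atTop_mul_neg (sub_neg.2 ha) hlim)
  refine hexp.congr' ?_
  filter_upwards [eventually_gt_atTop 0] with n hn
  have hn0 : (n : ℝ) ≠ 0 := Nat.cast_ne_zero.2 hn.ne'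
  have hpow : ∀ i, (Fintype.card (Fin (k n i) → F) : ℝ) =
      Real.exp (k n i * Real.log (Fintype.card F)) := by
    intro i
    rw [Real.exp_nat_mul, Real.exp_log hF, Fintype.card_fun, Fintype.card_fin, Nat.cast_pow]
  simp_rw [hpow]
  rw [← Real.exp_sum, ← Real.exp_add, Function.comp_apply]
  congr 1
  rw [mul_sub, mul_neg, ← sub_eq_add_neg, Finset.sum_mul, Finset.mul_sum]
  congr 1
  refine Finset.sum_congr rfl fun i _ => ?_
  rw [Real.logb]
  field_simp

end OSRB

theorem mainTheorem5 {F : Type*} [Field F] [Fintype F] [DecidableEq F]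
    {C : Type*} [Fintype C] {t : ℕ} (l : Fin t → ℕ)
    (p : PMF ((∀ i : Fin t, Fin (l i) → F) × C))
    (R : Fin t → ℝ)
    (hR : ∀ S : Finset (Fin t), S.Nonempty →
      ∑ i ∈ S, R i < OSRB.condEntropy (OSRB.subsetPmf p S))
    (k : ℕ → Fin t → ℕ)
    (hk : ∀ i, Tendsto (fun n : ℕ => (k n i : ℝ) * Real.logb 2 (Fintype.card F) / n)
      atTop (𝓝 (R i))) :
    Tendsto (fun n : ℕ => OSRB.expectedDistance p n
        fun i => OSRB.linearBinningLaw F n (l i) (k n i)) atTop (𝓝 0) ∧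
    ∀ law : ∀ (n : ℕ) (i : Fin t), PMF ((Fin n → Fin (l i) → F) → (Fin (k n i) → F)),
      (∀ n i, OSRB.IsUniformBinning (law n i)) →
      (∀ n i, OSRB.IsPairwiseIndepBinning (law n i)) →
      Tendsto (fun n : ℕ => OSRB.expectedDistance p n (law n)) atTop (𝓝 0) := by
  have hlog : 0 < Real.log 2 := Real.log_pos one_lt_two
  have hex : ∀ S : Finset (Fin t), ∃ a : ℝ, S.Nonempty → (∑ i ∈ S, R i) * Real.log 2 < a ∧
      a < OSRB.condEntropy (OSRB.subsetPmf p S) * Real.log 2 := by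
    intro S
    by_cases hS : S.Nonempty
    · obtain ⟨a, ha⟩ := exists_between (mul_lt_mul_of_pos_right (hR S hS) hlog)
      exact ⟨a, fun _ => ha⟩
    · exact ⟨0, fun h => absurd h hS⟩
  choose a ha using hex
  have main := OSRB.tendsto_expectedDistance (Y := fun n i => Fin (k n i) → F) p a
    (fun S hS => (ha S hS).2) fun S hS => OSRB.tendsto_prod_card_mul_exp hk (ha S hS).1
  exact ⟨main _ (fun n i => OSRB.isUniformBinning_linearBinningLaw n (l i) (k n i))
    fun n i => OSRB.isPairwiseIndepBinning_linearBinningLaw n (l i) (k n i), main⟩
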